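/- Let $G$ be a connected 3-dimensional real Lie group whose Lie algebra $L$ of left-invariant vector fields is unimodular ($\operatorname{tr}\operatorname{ad}_x=0$ for all $x\in L$), with a left-invariant contact sub-Riemannian structure given by a left-invariant orthonormal frame $f_1,f_2\in L$; contact means that $f_0:=[f_2,f_1]$, $f_1$, $f_2$ are linearly independent. (This covers in particular the frames in the normal form $[f_2,f_1]=f_0$, $[f_1,f_0]=(\chi+\kappa)f_2$, $[f_2,f_0]=(\chi-\kappa)f_1$ with $\chi\ge 0$, $\kappa\in\mathbb R$.) Let $e_i=\iota_*f_i$, where $\iota(q)=q^{-1}$, be the corresponding right-invariant vector fields, and let $\pi:T^*G\to G$ be the projection. For $\lambda\in T^*G$ put $h_i(\lambda)=\langle\lambda,f_i(\pi(\lambda))\rangle$, $g_i(\lambda)=\langle\lambda,e_i(\pi(\lambda))\rangle$ $(i=0,1,2)$ and $H=\tfrac12(h_1^2+h_2^2)$. Let $\sigma=ds$, with $s_\lambda=\lambda\circ\pi_*$, be the canonical symplectic form on $T^*G$, let the Hamiltonian vector field $\vec a$ of a smooth function $a$ be defined by $\sigma(\cdot,\vec a)=da$, and let $\{a,b\}=\sigma(\vec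 a,\vec b)$. Then $g_0,g_1,g_2$ are integrals of $\vec H$, that is, $\{H,g_i\}=0$, and the functions $H,g_0,g_1,g_2$ are functionally independent on $\{\lambda\in T^*G: h_0(\lambda)h_1(\lambda)\neq0\}$, that is, their differentials are linearly independent at every point of this set. Moreover, $\vec H$ is superintegrable (integrable in the noncommutative sense) with $d=3$, $n=2$, by means of $F=(F_1,F_2,F_3,F_4)=(H,g_0,g_1,g_2)$. That is, $\dim T^*G=2d$; the $2d-n$ functions $F_i$ are smooth integrals of $\vec H$, functionally independent on an open dense subset of $T^*G$; and there are functions $P_{ij}:F(T^*G)\to\mathbb R$ such that $\{F_i,F_j\}=P_{ij}\circ F$ for all $i,j$ and the matrix $(P_{ij})$ has rank $2d-2n$ on an open dense subset of $F(T^*G)$. -/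

import Mathlib

open Bundle VectorField
open scoped Manifold ContDiff

noncomputable section

/-! ### Hamiltonian mechanics on a manifold with a two-form -/

section Hamiltonian

variable {E : Type*} [NormedAddCommGroup E] [NormedSpace ℝ E]
  {H : Type*} [TopologicalSpace H] (I : ModelWithCorners ℝ E H)
  {M : Type*} [TopologicalSpace M] [ChartedSpace H M]

/-- The differential `d_x f` of a real function, as an element of the cotangent space at `x`. -/
def differential (f : M → ℝ) (x : M) : TangentSpace I x →L[ℝ] ℝ :=
  mfderiv I 𝓘(ℝ, ℝ) f x

/-- The expression of a one-form in the preferred chart at `x₀`: the pullback of the form by the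
inverse chart, a field of covectors on the model vector space. -/
def oneFormInChart (α : (x : M) → TangentSpace I x →L[ℝ] ℝ) (x₀ : M) (y : E) : E →L[ℝ] ℝ :=
  (α ((extChartAt I x₀).symm y)).comp (mfderiv 𝓘(ℝ, E) I (extChartAt I x₀).symm y)

/-- The exterior derivative of a one-form `α`, computed in the preferred chart:
`dα(v, w) = (D_v α)(w) - (D_w α)(v)`. -/
def oneFormExtDeriv (α : (x : M) → TangentSpace I x →L[ℝ] ℝ) (x : M) :
    LinearMap.BilinForm ℝ (TangentSpace I x) :=
  let A : LinearMap.BilinForm ℝ E :=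
    (fderiv ℝ (oneFormInChart I α x) (extChartAt I x x)).toBilinForm
  let D : TangentSpace I x →ₗ[ℝ] E := (mfderiv I 𝓘(ℝ, E) (extChartAt I x) x).toLinearMap
  LinearMap.BilinForm.comp (A - A.flip) D D

variable (σ : (x : M) → LinearMap.BilinForm ℝ (TangentSpace I x))

/-- The Hamiltonian vector field of `f` with respect to the two-form `σ`: its value at `x` is the
vector `X` with `σ_x(·, X) = d_x f` (unique if `σ_x` is nondegenerate). -/
def hamiltonianField (f : M → ℝ) (x : M) : TangentSpace I x :=
  Classical.epsilon fun X : TangentSpace I x => ∀ v, σ x v X = differential I f x v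

/-- The Poisson bracket `{a, b} = σ(X_a, X_b)`, which equals the derivative of `b` along `X_a`. -/
def poissonBracket (a b : M → ℝ) (x : M) : ℝ :=
  σ x (hamiltonianField I σ a x) (hamiltonianField I σ b x)

/-- Functional independence on a set: the differentials are linearly independent at each of its
points. -/
def FunctionallyIndependentOn {ι : Type*} (f : ι → M → ℝ) (S : Set M) : Prop :=
  ∀ x ∈ S, LinearIndependent ℝ fun i => differential I (f i) x

/-- The functions `f 0, …, f (m - 1)`, with `m = 2 d - n`, make the Hamiltonian vector field of
`f 0` superintegrable (integrable in the noncommutative sense) on the `2 d`-dimensional symplectic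
manifold `(M, σ)`. -/
structure IsSuperintegrableBy (d n : ℕ) {m : ℕ} [NeZero m] (f : Fin m → M → ℝ) : Prop where
  finrank_eq : Module.finrank ℝ E = 2 * d
  card_eq : m + n = 2 * d
  nondegenerate : ∀ x, (σ x).Nondegenerate
  smooth : ∀ i, ContMDiff I 𝓘(ℝ, ℝ) ∞ (f i)
  /-- every `f i` is a first integral of the Hamiltonian vector field of `f 0` -/
  integral : ∀ i x, poissonBracket I σ (f 0) (f i) x = 0
  independent : ∃ U : Set M, IsOpen U ∧ Dense U ∧ FunctionallyIndependentOn I f U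
  /-- the brackets are functions `P i j` of the integrals, and the matrix `P` has rank `2 d - 2 n`
  on a (relatively) open dense subset of the image of `(f 0, …, f (m - 1))` -/
  brackets : ∃ P : Set.range (fun x i => f i x) → Matrix (Fin m) (Fin m) ℝ,
    (∀ i j x, poissonBracket I σ (f i) (f j) x = P ⟨fun k => f k x, x, rfl⟩ i j) ∧
    ∃ V : Set (Set.range (fun x i => f i x)), IsOpen V ∧ Dense V ∧
      ∀ y ∈ V, (P y).rank + 2 * n = 2 * d

/-- The Hamiltonian vector field of `h` is superintegrable: it admits `2 d - n` integrals
`f 0 = h, f 1, …` as in `IsSuperintegrableBy`. -/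
def IsSuperintegrable (d n : ℕ) (h : M → ℝ) : Prop :=
  ∃ (m : ℕ) (_ : NeZero m) (f : Fin m → M → ℝ), f 0 = h ∧ IsSuperintegrableBy I σ d n f

end Hamiltonian

/-! ### The cotangent bundle and its canonical symplectic form -/

section Cotangent

variable {E : Type*} [NormedAddCommGroup E] [NormedSpace ℝ E]
  {H : Type*} [TopologicalSpace H] (I : ModelWithCorners ℝ E H)
  (M : Type*) [TopologicalSpace M] [ChartedSpace H M]

/-- The cotangent bundle of `M`: points are pairs `⟨q, p⟩` with `p : T_q M →L[ℝ] ℝ`. -/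
abbrev CotangentBundle : Type _ :=
  TotalSpace (E →L[ℝ] ℝ) fun q : M => TangentSpace I q →L[ℝ] ℝ

variable [IsManifold I 1 M]

/-- The model with corners of the cotangent bundle. -/
abbrev cotangentModel : ModelWithCorners ℝ (E × (E →L[ℝ] ℝ)) (ModelProd H (E →L[ℝ] ℝ)) :=
  I.prod 𝓘(ℝ, E →L[ℝ] ℝ)

/-- The tautological (Liouville) one-form `s_l = l ∘ π_*` on the cotangent bundle. -/
def liouvilleForm (l : CotangentBundle I M) :
    TangentSpace (cotangentModel I) l →L[ℝ] ℝ :=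
  l.2.comp (mfderiv (cotangentModel I) I (fun μ : CotangentBundle I M => μ.1) l)

/-- The canonical symplectic form `σ = ds` on the cotangent bundle. -/
def canonicalForm (l : CotangentBundle I M) :
    LinearMap.BilinForm ℝ (TangentSpace (cotangentModel I) l) :=
  oneFormExtDeriv (cotangentModel I) (liouvilleForm I M) l

variable {M} in
/-- The function `l ↦ ⟨l, V(π l)⟩` on the cotangent bundle, linear on fibres, defined by a vector
field `V`. -/
def linearHamiltonian (V : (q : M) → TangentSpace I q) (l : CotangentBundle I M) : ℝ :=
  l.2 (V l.1)

end Cotangent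

/-! ### Left-invariant sub-Riemannian structures on Lie groups -/

section Group

variable {E : Type*} [NormedAddCommGroup E] [NormedSpace ℝ E] [CompleteSpace E]
  {H : Type*} [TopologicalSpace H] (I : ModelWithCorners ℝ E H)
  (G : Type*) [Group G] [TopologicalSpace G] [ChartedSpace H G]

instance lieGroupMinSmoothness [LieGroup I ∞ G] : LieGroup I (minSmoothness ℝ 3) G := by
  rw [minSmoothness_of_isRCLikeNormedField]
  infer_instance

/-- The Lie algebra of `G` is unimodular: every `ad x` has trace zero. -/
def IsUnimodular [LieGroup I ∞ G] : Prop :=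
  ∀ x : GroupLieAlgebra I G, LinearMap.trace ℝ _ (LieAlgebra.ad ℝ (GroupLieAlgebra I G) x) = 0

variable {G}

/-- The right-invariant vector field `e = i_* f`, where `f` is the left-invariant field with value
`v` at the identity and `i(q) = q⁻¹`. As `i` is an involution, the pushforward by `i` is the
pullback by `i`. -/
def rightInvariantField (v : GroupLieAlgebra I G) (q : G) : TangentSpace I q :=
  mpullback I I (fun a : G => a⁻¹) (mulInvariantVectorField v) q

variable [IsManifold I 1 G]

/-- The left-invariant Hamiltonian `h(l) = ⟨l, f(π l)⟩`, with `f` the left-invariant field given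
by `v`. -/
def leftHamiltonian (v : GroupLieAlgebra I G) : CotangentBundle I G → ℝ :=
  linearHamiltonian I (mulInvariantVectorField v)

/-- The right-invariant Hamiltonian `g(l) = ⟨l, e(π l)⟩`, with `e = i_* f` and `f` the
left-invariant field given by `v`. -/
def rightHamiltonian (v : GroupLieAlgebra I G) : CotangentBundle I G → ℝ :=
  linearHamiltonian I (rightInvariantField I v)

/-- The Hamiltonian `(h₁² + h₂²) / 2` of the sub-Riemannian structure with left-invariant
orthonormal frame `f₁, f₂`. -/
def subRiemannianHamiltonian (f₁ f₂ : GroupLieAlgebra I G) (l : CotangentBundle I G) : ℝ :=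
  (leftHamiltonian I f₁ l ^ 2 + leftHamiltonian I f₂ l ^ 2) / 2

end Group

end

/-!
For a vector field `V` on a manifold `M` let `⟨·, V⟩` be the fibrewise linear function
`l ↦ ⟨l, V(π l)⟩` on `T*M`. In the charts of the cotangent bundle induced by the charts of `M` the
tautological form is `p dx` (`oneFormInChart_liouvilleForm`). Hence the canonical form is
nondegenerate, the Hamiltonian vector fields chosen by `hamiltonianField` do satisfy their defining
equation, and `{⟨·, V⟩, ⟨·, W⟩} = ⟨·, [V, W]⟩` (`poissonBracket_linearHamiltonian`).

On a Lie group, left-invariant fields `f` and right-invariant fields `e` commute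
(`mlieBracket_rightInvariantField_mulInvariantVectorField`): near `q` they are the partial
derivatives of `(a, b) ↦ a⁻¹ * q * b` in `b` and in `a`, and mixed second derivatives are symmetric.
Moreover `f ↦ i_* f` respects brackets. Therefore `{gᵢ, hⱼ} = 0`, while the `gᵢ` and the `hᵢ` both
close under the bracket with the structure constants of the Lie algebra.

As `H` is a function of `h₁, h₂`, it commutes with every `gᵢ`. The `dgᵢ` are independent already
along the fibres. The Hamiltonian vector field of `h₂` annihilates every `gᵢ`, whereas
`{h₂, H} = h₁ {h₂, h₁} = h₁ h₀`. So `dH` is independent of the `dgᵢ` wherever `h₀ h₁ ≠ 0`, and this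
set is open and dense, each factor being a nonzero linear form on each fibre.

Finally, the matrix of brackets of `H, g₀, g₁, g₂` is skew-symmetric with a vanishing row for `H`,
so that its rank is two wherever it is not zero, in particular wherever `{g₂, g₁} = g₀` is not zero.
That set is dense in `T*G`, hence its image is dense in the image of `(H, g₀, g₁, g₂)`.
-/

/-! ### Coordinates on the cotangent bundle and the canonical form -/

section
variable {E : Type*} [NormedAddCommGroup E] [NormedSpace ℝ E]
  {H : Type*} [TopologicalSpace H] (I : ModelWithCorners ℝ E H)
  {M : Type*} [TopologicalSpace M] [ChartedSpace H M] [IsManifold I 1 M]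

lemma extChartAt_cotangentBundle_fst (l₀ l : CotangentBundle I M) :
    (extChartAt (cotangentModel I) l₀ l).1 = extChartAt I l₀.1 l.1 := by
  simp only [extChartAt, OpenPartialHomeomorph.extend_coe, Function.comp_apply]
  rw [hom_chart]
  simp

lemma mem_extChartAt_cotangentBundle_source {l₀ l : CotangentBundle I M} :
    l ∈ (extChartAt (cotangentModel I) l₀).source ↔ l.1 ∈ (extChartAt I l₀.1).source := by
  rw [extChartAt_source, extChartAt_source]
  simp [FiberBundle.chartedSpace_chartAt, hom_trivializationAt_apply]

/-- The fibre coordinate of a covector is its expression in the frame given by the chart of the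
base: evaluated on the coordinates of a tangent vector, it gives the pairing. -/
lemma extChartAt_cotangentBundle_snd {l₀ l : CotangentBundle I M}
    (hl : l.1 ∈ (extChartAt I l₀.1).source) (v : TangentSpace I l.1) :
    (extChartAt (cotangentModel I) l₀ l).2 (mfderiv I 𝓘(ℝ, E) (extChartAt I l₀.1) l.1 v) =
      l.2 v := by
  simp only [extChartAt, OpenPartialHomeomorph.extend_coe, Function.comp_apply]
  rw [hom_chart]
  rw [extChartAt_source] at hl
  have h := TangentBundle.continuousLinearMapAt_trivializationAt (I := I) (M := M) hl
  simp only [extChartAt, OpenPartialHomeomorph.extend_coe] at h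
  rw [← h]
  have := Trivialization.symmL_continuousLinearMapAt (R := ℝ)
    (trivializationAt E (TangentSpace I) l₀.1) (b := l.1) (by simpa using hl) v
  simp only [ContinuousLinearMap.inCoordinates, Trivial.fiberBundle_trivializationAt',
    Trivial.continuousLinearMapAt_trivialization, ContinuousLinearMap.id_comp,
    modelWithCorners_prod_coe, modelWithCornersSelf_coe, Prod.map_apply, id_eq]
  exact congrArg l.2 this

lemma extChartAt_cotangentBundle_symm {l₀ : CotangentBundle I M}
    {y : E × (E →L[ℝ] ℝ)}
    (hy : y ∈ (extChartAt (cotangentModel I) l₀).target) :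
    ((extChartAt (cotangentModel I) l₀).symm y).1 ∈ (extChartAt I l₀.1).source ∧
    y.1 ∈ (extChartAt I l₀.1).target ∧
    ((extChartAt (cotangentModel I) l₀).symm y).1 = (extChartAt I l₀.1).symm y.1 := by
  set l := (extChartAt (cotangentModel I) l₀).symm y with hl
  have hs : l.1 ∈ (extChartAt I l₀.1).source :=
    (mem_extChartAt_cotangentBundle_source I).1 ((extChartAt (cotangentModel I) l₀).map_target hy)
  have h := (extChartAt (cotangentModel I) l₀).right_inv hy
  have h1 := extChartAt_cotangentBundle_fst I l₀ l
  rw [hl, h, ← hl] at h1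
  refine ⟨hs, h1 ▸ (extChartAt I l₀.1).map_source hs, ?_⟩
  rw [h1, (extChartAt I l₀.1).left_inv hs]

lemma extChartAt_cotangentBundle_symm_snd {l₀ : CotangentBundle I M}
    {y : E × (E →L[ℝ] ℝ)}
    (hy : y ∈ (extChartAt (cotangentModel I) l₀).target)
    (v : TangentSpace I ((extChartAt (cotangentModel I) l₀).symm y).1) :
    ((extChartAt (cotangentModel I) l₀).symm y).2 v =
      y.2 (mfderiv I 𝓘(ℝ, E) (extChartAt I l₀.1) _ v) := by
  have h := extChartAt_cotangentBundle_snd I (extChartAt_cotangentBundle_symm I hy).1 v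
  rw [(extChartAt (cotangentModel I) l₀).right_inv hy] at h
  exact h.symm

/-- In the preferred charts the tautological form is `p dx`. -/
lemma oneFormInChart_liouvilleForm [IsManifold I 2 M] [I.Boundaryless] {l₀ : CotangentBundle I M}
    {y : E × (E →L[ℝ] ℝ)} (hy : y ∈ (extChartAt (cotangentModel I) l₀).target) :
    oneFormInChart (cotangentModel I) (liouvilleForm I M) l₀ y =
      y.2.comp (ContinuousLinearMap.fst ℝ E (E →L[ℝ] ℝ)) := by
  refine ContinuousLinearMap.ext fun w => ?_
  obtain ⟨hs, -, -⟩ := extChartAt_cotangentBundle_symm I hy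
  have hsymm := mdifferentiableWithinAt_extChartAt_symm (I := cotangentModel I) hy
  rw [ModelWithCorners.range_eq_univ, mdifferentiableWithinAt_univ] at hsymm
  have hproj : MDifferentiableAt (cotangentModel I) I (fun μ : CotangentBundle I M => μ.1)
      ((extChartAt (cotangentModel I) l₀).symm y) :=
    (contMDiff_proj (n := 1) (IB := I) (fun q : M => TangentSpace I q →L[ℝ] ℝ)).mdifferentiable
      one_ne_zero _
  have hφ : MDifferentiableAt I 𝓘(ℝ, E) (extChartAt I l₀.1)
      ((extChartAt (cotangentModel I) l₀).symm y).1 :=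
    mdifferentiableAt_extChartAt (by simpa using hs)
  -- the chart of the bundle covers the chart of the base, so `π` reads as the first projection
  have key : mfderiv 𝓘(ℝ, E × (E →L[ℝ] ℝ)) 𝓘(ℝ, E) (fun z => extChartAt I l₀.1
      ((extChartAt (cotangentModel I) l₀).symm z).1) y =
        ContinuousLinearMap.fst ℝ E (E →L[ℝ] ℝ) := by
    have : (fun z => extChartAt I l₀.1 ((extChartAt (cotangentModel I) l₀).symm z).1)
        =ᶠ[nhds y] Prod.fst := by
      filter_upwards [(isOpen_extChartAt_target (I := cotangentModel I) l₀).mem_nhds hy] with z hz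
      obtain ⟨-, ht, h1⟩ := extChartAt_cotangentBundle_symm I hz
      rw [h1, (extChartAt I l₀.1).right_inv ht]
    rw [this.mfderiv_eq, mfderiv_eq_fderiv]
    exact fderiv_fst
  have h2 := mfderiv_comp y (hφ.comp _ hproj) hsymm
  rw [mfderiv_comp _ hφ hproj] at h2
  have h3 := congrArg (fun T : (E × (E →L[ℝ] ℝ)) →L[ℝ] E => T w) (h2.symm.trans key)
  have := extChartAt_cotangentBundle_symm_snd I hy
   (mfderiv (cotangentModel I) I (fun μ : CotangentBundle I M => μ.1) _
    (mfderiv 𝓘(ℝ, E × (E →L[ℝ] ℝ)) (cotangentModel I) (extChartAt (cotangentModel I) l₀).symm y w))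
  exact this.trans (congrArg y.2 h3)

/-- The differential at `l` of the preferred chart of the cotangent bundle at `l`. It splits a
tangent vector at `l` into a horizontal part in `E` and a vertical part in the dual of `E`. -/
noncomputable def cotangentCoord (l : CotangentBundle I M) :
    TangentSpace (cotangentModel I) l →L[ℝ] E × (E →L[ℝ] ℝ) :=
  mfderiv (cotangentModel I) 𝓘(ℝ, E × (E →L[ℝ] ℝ)) (extChartAt (cotangentModel I) l) l

lemma cotangentCoord_bijective [IsManifold I 2 M] (l : CotangentBundle I M) :
    Function.Bijective (cotangentCoord I l) := by
  obtain ⟨D, hD⟩ := isInvertible_mfderiv_extChartAt (I := cotangentModel I)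
    (mem_extChartAt_source (I := cotangentModel I) l)
  unfold cotangentCoord
  rw [← hD]
  exact D.bijective

/-- The canonical form is `dp ∧ dx` in the coordinates of the preferred chart. -/
lemma canonicalForm_apply [IsManifold I 2 M] [I.Boundaryless] (l : CotangentBundle I M)
    (v w : TangentSpace (cotangentModel I) l) :
    canonicalForm I M l v w =
      (cotangentCoord I l v).2 (cotangentCoord I l w).1 -
        (cotangentCoord I l w).2 (cotangentCoord I l v).1 := by
  have h : oneFormInChart (cotangentModel I) (liouvilleForm I M) l
      =ᶠ[nhds (extChartAt (cotangentModel I) l l)]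
      ((ContinuousLinearMap.compL ℝ (E × (E →L[ℝ] ℝ)) E ℝ).flip
        (ContinuousLinearMap.fst ℝ E (E →L[ℝ] ℝ))).comp
        (ContinuousLinearMap.snd ℝ E (E →L[ℝ] ℝ)) := by
    filter_upwards [extChartAt_target_mem_nhds (I := cotangentModel I) l] with y hy
    rw [oneFormInChart_liouvilleForm I hy]
    rfl
  unfold canonicalForm oneFormExtDeriv
  rw [h.fderiv_eq, ContinuousLinearMap.fderiv]
  rfl

lemma canonicalForm_swap [IsManifold I 2 M] [I.Boundaryless] (l : CotangentBundle I M)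
    (v w : TangentSpace (cotangentModel I) l) :
    canonicalForm I M l v w = - canonicalForm I M l w v := by
  rw [canonicalForm_apply, canonicalForm_apply, neg_sub]

lemma nondegenerate_canonicalForm [IsManifold I 2 M] [I.Boundaryless] (l : CotangentBundle I M) :
    (canonicalForm I M l).Nondegenerate := by
  have hleft : (canonicalForm I M l).SeparatingLeft := by
    intro v hv
    have hv' : ∀ (x : E) (p : E →L[ℝ] ℝ),
        (cotangentCoord I l v).2 x - p (cotangentCoord I l v).1 = 0 := by
      intro x p
      obtain ⟨w, hw⟩ := (cotangentCoord_bijective I l).2 (x, p)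
      simpa [canonicalForm_apply, hw] using hv w
    apply (cotangentCoord_bijective I l).1
    rw [(cotangentCoord I l).map_zero]
    refine Prod.ext (SeparatingDual.eq_zero_of_forall_dual_eq_zero (R := ℝ) fun p => ?_) ?_
    · simpa using hv' 0 p
    · ext x
      simpa using hv' x 0
  refine ⟨hleft, fun w hw => hleft w fun v => ?_⟩
  rw [canonicalForm_swap, hw, neg_zero]

end

section
variable {E : Type*} [NormedAddCommGroup E] [NormedSpace ℝ E] [FiniteDimensional ℝ E]
  {H : Type*} [TopologicalSpace H] {I : ModelWithCorners ℝ E H}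
  {M : Type*} [TopologicalSpace M] [ChartedSpace H M]
  {σ : (x : M) → LinearMap.BilinForm ℝ (TangentSpace I x)}

/-- For a nondegenerate form the choice in `hamiltonianField` is not vacuous: in finite dimension
the defining equation `σ(·, X) = df` has a solution. -/
lemma apply_hamiltonianField {x : M} (hσ : (σ x).Nondegenerate) (f : M → ℝ)
    (v : TangentSpace I x) : σ x v (hamiltonianField I σ f x) = differential I f x v := by
  have : FiniteDimensional ℝ (TangentSpace I x) := inferInstanceAs (FiniteDimensional ℝ E)
  have h : ∃ X : TangentSpace I x, ∀ v, σ x v X = differential I f x v := by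
    have hflip : (σ x).flip.Nondegenerate := hσ.flip
    refine ⟨((σ x).flip.toDual hflip).symm (differential I f x).toLinearMap, fun v => ?_⟩
    have := LinearMap.BilinForm.apply_toDual_symm_apply (hB := hflip)
      (differential I f x).toLinearMap v
    exact this
  exact Classical.epsilon_spec h v

lemma poissonBracket_eq_differential {x : M} (hσ : (σ x).Nondegenerate) (a b : M → ℝ) :
    poissonBracket I σ a b x = differential I b x (hamiltonianField I σ a x) :=
  apply_hamiltonianField hσ b _

end

/-! ### Poisson brackets of fibrewise linear functions -/

section
variable {E : Type*} [NormedAddCommGroup E] [NormedSpace ℝ E]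
  {H : Type*} [TopologicalSpace H] (I : ModelWithCorners ℝ E H)
  {M : Type*} [TopologicalSpace M] [ChartedSpace H M]

/-- The expression of a vector field in the preferred chart at `q₀`. -/
noncomputable def fieldInChart (V : (q : M) → TangentSpace I q) (q₀ : M) : E → E :=
  mpullbackWithin 𝓘(ℝ, E) I (extChartAt I q₀).symm V (Set.range I)

lemma fieldInChart_extChartAt [IsManifold I 1 M] (V : (q : M) → TangentSpace I q) {q₀ q : M}
    (hq : q ∈ (extChartAt I q₀).source) :
    fieldInChart I V q₀ (extChartAt I q₀ q) = mfderiv I 𝓘(ℝ, E) (extChartAt I q₀) q (V q) := by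
  have ht := (extChartAt I q₀).map_source hq
  have hl := (extChartAt I q₀).left_inv hq
  have h1 := mfderiv_extChartAt_comp_mfderivWithin_extChartAt_symm (I := I) ht
  have h2 := mfderivWithin_extChartAt_symm_comp_mfderiv_extChartAt (I := I) ht
  have h3 := ContinuousLinearMap.inverse_eq h2 h1
  unfold fieldInChart
  rw [mpullbackWithin_apply, h3, hl]

/-- The coordinate formula for the Lie bracket of vector fields. -/
lemma mfderiv_extChartAt_mlieBracket [IsManifold I 1 M] [I.Boundaryless]
    (V W : (q : M) → TangentSpace I q) (q : M) :
    (mfderiv I 𝓘(ℝ, E) (extChartAt I q) q (mlieBracket I V W q) : E) =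
      fderiv ℝ (fieldInChart I W q) (extChartAt I q q) (fieldInChart I V q (extChartAt I q q)) -
      fderiv ℝ (fieldInChart I V q) (extChartAt I q q) (fieldInChart I W q (extChartAt I q q)) := by
  have h : mlieBracket I V W q = (mfderiv I 𝓘(ℝ, E) (extChartAt I q) q).inverse
      (lieBracketWithin (E := E) ℝ (fieldInChart I V q) (fieldInChart I W q)
        ((extChartAt I q).symm ⁻¹' Set.univ ∩ Set.range I) (extChartAt I q q)) := rfl
  rw [Set.preimage_univ, Set.univ_inter, ModelWithCorners.range_eq_univ,
    lieBracketWithin_univ] at h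
  obtain ⟨D, hD⟩ := isInvertible_mfderiv_extChartAt (I := I) (mem_extChartAt_source (I := I) q)
  rw [h, ← hD, ContinuousLinearMap.inverse_equiv]
  exact D.apply_symm_apply _

variable [CompleteSpace E] [IsManifold I 1 M] [IsManifold I 2 M] [I.Boundaryless]

lemma differentiableAt_fieldInChart {V : (q : M) → TangentSpace I q} {q₀ : M}
    (hV : MDifferentiableAt I I.tangent (fun q => (⟨q, V q⟩ : TangentBundle I M)) q₀) :
    DifferentiableAt ℝ (fieldInChart I V q₀) (extChartAt I q₀ q₀) := by
  rw [← mdifferentiableWithinAt_univ] at hV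
  have h : DifferentiableWithinAt ℝ (fieldInChart I V q₀)
      ((extChartAt I q₀).symm ⁻¹' Set.univ ∩ Set.range I) (extChartAt I q₀ q₀) :=
    hV.differentiableWithinAt_mpullbackWithin_vectorField
  rwa [Set.preimage_univ, Set.univ_inter, ModelWithCorners.range_eq_univ,
    differentiableWithinAt_univ] at h

/-- In coordinates `l ↦ ⟨l, V⟩` is `(x, p) ↦ p (V x)`, with differential
`(ẋ, ṗ) ↦ ṗ (V x) + p (DV ẋ)`. -/
lemma differential_linearHamiltonian {V : (q : M) → TangentSpace I q} {l : CotangentBundle I M}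
    (hV : MDifferentiableAt I I.tangent (fun q => (⟨q, V q⟩ : TangentBundle I M)) l.1)
    (v : TangentSpace (cotangentModel I) l) :
    differential (cotangentModel I) (linearHamiltonian I V) l v =
      (cotangentCoord I l v).2 (fieldInChart I V l.1 (extChartAt I l.1 l.1)) +
      (extChartAt (cotangentModel I) l l).2
        (fderiv ℝ (fieldInChart I V l.1) (extChartAt I l.1 l.1) (cotangentCoord I l v).1) := by
  set F : E × (E →L[ℝ] ℝ) → ℝ := fun y => y.2 (fieldInChart I V l.1 y.1) with hF
  have h1 : linearHamiltonian I V =ᶠ[nhds l] F ∘ extChartAt (cotangentModel I) l := by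
    filter_upwards [extChartAt_source_mem_nhds (I := cotangentModel I) l] with l' hl'
    rw [mem_extChartAt_cotangentBundle_source] at hl'
    rw [hF, Function.comp_apply, extChartAt_cotangentBundle_fst, fieldInChart_extChartAt I V hl',
      extChartAt_cotangentBundle_snd I hl']
    rfl
  have hfst := extChartAt_cotangentBundle_fst I l l
  have hd : HasFDerivAt F _ (extChartAt (cotangentModel I) l l) :=
    HasFDerivAt.clm_apply (c := fun y : E × (E →L[ℝ] ℝ) => y.2)
      (u := fun y : E × (E →L[ℝ] ℝ) => fieldInChart I V l.1 y.1) hasFDerivAt_snd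
      (HasFDerivAt.comp (g := fieldInChart I V l.1) _
        (hfst ▸ (differentiableAt_fieldInChart I hV).hasFDerivAt) hasFDerivAt_fst)
  have hΦ : MDifferentiableAt (cotangentModel I) 𝓘(ℝ, E × (E →L[ℝ] ℝ))
      (extChartAt (cotangentModel I) l) l :=
    mdifferentiableAt_extChartAt (mem_chart_source _ _)
  unfold differential
  rw [h1.mfderiv_eq, mfderiv_comp l hd.differentiableAt.mdifferentiableAt hΦ, mfderiv_eq_fderiv,
    hd.fderiv]
  rw [hfst]
  exact add_comm _ _

/-- Fibrewise linear functions bracket as the vector fields that define them. -/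
lemma poissonBracket_linearHamiltonian [FiniteDimensional ℝ E]
    {V W : (q : M) → TangentSpace I q} {l : CotangentBundle I M}
    (hV : MDifferentiableAt I I.tangent (fun q => (⟨q, V q⟩ : TangentBundle I M)) l.1)
    (hW : MDifferentiableAt I I.tangent (fun q => (⟨q, W q⟩ : TangentBundle I M)) l.1) :
    poissonBracket (cotangentModel I) (canonicalForm I M) (linearHamiltonian I V)
      (linearHamiltonian I W) l = linearHamiltonian I (mlieBracket I V W) l := by
  set X := hamiltonianField (cotangentModel I) (canonicalForm I M) (linearHamiltonian I V) l
    with hX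
  have hspec : ∀ v, canonicalForm I M l v X =
      differential (cotangentModel I) (linearHamiltonian I V) l v :=
    apply_hamiltonianField (nondegenerate_canonicalForm I l) _
  -- testing `σ(·, X)` on vertical and on horizontal vectors gives Hamilton's equations
  -- `ẋ = V x`, `ṗ = -p ∘ DV`
  have hX1 : (cotangentCoord I l X).1 = fieldInChart I V l.1 (extChartAt I l.1 l.1) := by
    refine (SeparatingDual.eq_iff_forall_dual_eq (R := ℝ)).2 fun p => ?_
    obtain ⟨w, hw⟩ := (cotangentCoord_bijective I l).2 (0, p)
    have := hspec w
    rw [canonicalForm_apply, differential_linearHamiltonian I hV, hw] at this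
    simpa using this
  have hX2 : ∀ x, (cotangentCoord I l X).2 x = - (extChartAt (cotangentModel I) l l).2
        (fderiv ℝ (fieldInChart I V l.1) (extChartAt I l.1 l.1) x) := by
    intro x
    obtain ⟨w, hw⟩ := (cotangentCoord_bijective I l).2 (x, 0)
    have := hspec w
    rw [canonicalForm_apply, differential_linearHamiltonian I hV, hw] at this
    simp only [_root_.zero_apply, zero_sub, zero_add] at this
    rw [← this, neg_neg]
  rw [poissonBracket_eq_differential (nondegenerate_canonicalForm I l), ← hX,
    differential_linearHamiltonian I hW, hX1, hX2]
  have hl : l.1 ∈ (extChartAt I l.1).source := mem_extChartAt_source l.1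
  unfold linearHamiltonian
  rw [← extChartAt_cotangentBundle_snd I hl, mfderiv_extChartAt_mlieBracket, map_sub]
  ring

end

section
variable {E : Type*} [NormedAddCommGroup E] [NormedSpace ℝ E]
  {H : Type*} [TopologicalSpace H] (I : ModelWithCorners ℝ E H)
  {M : Type*} [TopologicalSpace M] [ChartedSpace H M] [IsManifold I 1 M]

lemma contMDiff_linearHamiltonian [IsManifold I ∞ M] {V : (q : M) → TangentSpace I q}
    (hV : ContMDiff I I.tangent ∞ (fun q => (⟨q, V q⟩ : TangentBundle I M))) :
    ContMDiff (cotangentModel I) 𝓘(ℝ, ℝ) ∞ (linearHamiltonian I V) := by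
  have hproj : ContMDiff (cotangentModel I) I ∞ (fun l : CotangentBundle I M => l.1) :=
    contMDiff_proj _
  have h := ContMDiff.clm_bundle_apply (IB := I) (F₁ := E) (F₂ := ℝ) (n := ∞)
    (E₁ := fun q : M => TangentSpace I q) (E₂ := fun _ : M => ℝ)
    (b := fun l : CotangentBundle I M => l.1) (ϕ := fun l : CotangentBundle I M => l.2)
    (v := fun l => V l.1) contMDiff_id (hV.comp hproj)
  intro l
  exact (contMDiffAt_totalSpace.1 (h l)).2

/-- On each fibre the function is a nonzero linear form, so its zeros can be moved away along a
line in the fibre. -/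
lemma dense_linearHamiltonian_ne_zero {V : (q : M) → TangentSpace I q} (hV : ∀ q, V q ≠ 0) :
    Dense {l : CotangentBundle I M | linearHamiltonian I V l ≠ 0} := by
  rintro ⟨q, p⟩
  by_cases h : p (V q) = 0
  · obtain ⟨p₀, hp₀⟩ : ∃ p₀ : E →L[ℝ] ℝ, p₀ (V q) ≠ 0 := by
      by_contra! hc
      exact hV q (SeparatingDual.eq_zero_of_forall_dual_eq_zero (R := ℝ) (V := E) hc)
    let c : ℝ → CotangentBundle I M := fun t => ⟨q, (show E →L[ℝ] ℝ from p) + t • p₀⟩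
    have hc : Continuous c :=
      (FiberBundle.continuous_totalSpaceMk (E →L[ℝ] ℝ)
        (fun q : M => TangentSpace I q →L[ℝ] ℝ) q).comp
        (show Continuous fun t : ℝ => (show E →L[ℝ] ℝ from p) + t • p₀ by fun_prop)
    have hc0 : c 0 = ⟨q, p⟩ := by
      have : (show E →L[ℝ] ℝ from p) + (0 : ℝ) • p₀ = p := by rw [zero_smul, add_zero]
      exact congrArg (TotalSpace.mk q) this
    refine mem_closure_of_tendsto (b := nhdsWithin (0 : ℝ) {0}ᶜ) (f := c) ?_ ?_
    · rw [← hc0]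
      exact (hc.tendsto 0).mono_left nhdsWithin_le_nhds
    · filter_upwards [self_mem_nhdsWithin] with t ht
      have : linearHamiltonian I V (c t) = p (V q) + t * p₀ (V q) := rfl
      change linearHamiltonian I V (c t) ≠ 0
      rw [this, h, zero_add]
      exact mul_ne_zero ht hp₀
  · exact subset_closure h

variable [IsManifold I 2 M] [I.Boundaryless]

lemma poissonBracket_canonicalForm_swap (a b : CotangentBundle I M → ℝ) (l : CotangentBundle I M) :
    poissonBracket (cotangentModel I) (canonicalForm I M) a b l =
      - poissonBracket (cotangentModel I) (canonicalForm I M) b a l :=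
  canonicalForm_swap I l _ _

end

/-! ### Invariant vector fields on a Lie group -/

section
variable {E : Type*} [NormedAddCommGroup E] [NormedSpace ℝ E]
  {F : Type*} [NormedAddCommGroup F] [NormedSpace ℝ F]

/-- Two vector fields that are the two families of partial derivatives of one map of class `C²`
commute. -/
lemma fderiv_apply_comm_of_partial_derivatives {Ψ : E × E → F} {x₀ y₀ : E} {v w : E}
    (hΨ : ContDiffAt ℝ 2 Ψ (x₀, y₀)) {R L : F → F} (hR : DifferentiableAt ℝ R (Ψ (x₀, y₀)))
    (hL : DifferentiableAt ℝ L (Ψ (x₀, y₀)))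
    (hR' : ∀ᶠ y in nhds y₀, R (Ψ (x₀, y)) = fderiv ℝ (fun x => Ψ (x, y)) x₀ v)
    (hL' : ∀ᶠ x in nhds x₀, L (Ψ (x, y₀)) = fderiv ℝ (fun y => Ψ (x, y)) y₀ w) :
    fderiv ℝ R (Ψ (x₀, y₀)) (L (Ψ (x₀, y₀))) = fderiv ℝ L (Ψ (x₀, y₀)) (R (Ψ (x₀, y₀))) := by
  have hΨ1 : ∀ᶠ p in nhds (x₀, y₀), DifferentiableAt ℝ Ψ p :=
    (hΨ.eventually (by simp)).mono fun p hp => hp.differentiableAt (by simp)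
  have hfst : ∀ᶠ p : E × E in nhds (x₀, y₀),
      fderiv ℝ (fun x => Ψ (x, p.2)) p.1 v = fderiv ℝ Ψ p (v, 0) := by
    filter_upwards [hΨ1] with p hp
    have := (HasFDerivAt.comp (g := Ψ) p.1 hp.hasFDerivAt
      (hasFDerivAt_prodMk_left (𝕜 := ℝ) p.1 p.2)).fderiv
    exact congrArg (fun T : E →L[ℝ] F => T v) this
  have hsnd : ∀ᶠ p : E × E in nhds (x₀, y₀),
      fderiv ℝ (fun y => Ψ (p.1, y)) p.2 w = fderiv ℝ Ψ p (0, w) := by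
    filter_upwards [hΨ1] with p hp
    have := (HasFDerivAt.comp (g := Ψ) p.2 hp.hasFDerivAt
      (hasFDerivAt_prodMk_right (𝕜 := ℝ) p.1 p.2)).fderiv
    exact congrArg (fun T : E →L[ℝ] F => T w) this
  have h0 := hΨ1.self_of_nhds
  have hD : DifferentiableAt ℝ (fderiv ℝ Ψ) (x₀, y₀) :=
    (hΨ.fderiv_right (m := 1) (by norm_num)).differentiableAt (by simp)
  have c1 : Filter.Tendsto (fun y => (x₀, y)) (nhds y₀) (nhds (x₀, y₀)) :=
    (Continuous.prodMk_right x₀).tendsto y₀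
  have c2 : Filter.Tendsto (fun x => (x, y₀)) (nhds x₀) (nhds (x₀, y₀)) :=
    (Continuous.prodMk_left y₀).tendsto x₀
  have e1 : (fun y => R (Ψ (x₀, y))) =ᶠ[nhds y₀] fun y => fderiv ℝ Ψ (x₀, y) (v, 0) := by
    filter_upwards [hR', c1.eventually hfst] with y h1 h2 using h1.trans h2
  have e2 : (fun x => L (Ψ (x, y₀))) =ᶠ[nhds x₀] fun x => fderiv ℝ Ψ (x, y₀) (0, w) := by
    filter_upwards [hL', c2.eventually hsnd] with x h1 h2 using h1.trans h2
  have d1 := (HasFDerivAt.comp y₀ hR.hasFDerivAt (HasFDerivAt.comp (g := Ψ) y₀ h0.hasFDerivAt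
    (hasFDerivAt_prodMk_right (𝕜 := ℝ) x₀ y₀))).unique
    (((HasFDerivAt.comp (g := fderiv ℝ Ψ) y₀ hD.hasFDerivAt
      (hasFDerivAt_prodMk_right (𝕜 := ℝ) x₀ y₀)).clm_apply
        (hasFDerivAt_const ((v, 0) : E × E) y₀)).congr_of_eventuallyEq e1)
  have d2 := (HasFDerivAt.comp x₀ hL.hasFDerivAt (HasFDerivAt.comp (g := Ψ) x₀ h0.hasFDerivAt
    (hasFDerivAt_prodMk_left (𝕜 := ℝ) x₀ y₀))).unique
    (((HasFDerivAt.comp (g := fderiv ℝ Ψ) x₀ hD.hasFDerivAt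
      (hasFDerivAt_prodMk_left (𝕜 := ℝ) x₀ y₀)).clm_apply
        (hasFDerivAt_const ((0, w) : E × E) x₀)).congr_of_eventuallyEq e2)
  have d1' := congrArg (fun T : E →L[ℝ] F => T w) d1
  have d2' := congrArg (fun T : E →L[ℝ] F => T v) d2
  have k1 := e1.self_of_nhds
  have k2 := e2.self_of_nhds
  simp only [ContinuousLinearMap.comp_apply, ContinuousLinearMap.inr_apply, Function.comp_apply,
    ContinuousLinearMap.comp_zero, zero_add, ContinuousLinearMap.flip_apply,
    ContinuousLinearMap.inl_apply] at d1' d2' k1 k2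
  rw [k1, k2, d1', d2']
  -- both sides are now mixed second partial derivatives of `Ψ`
  exact (hΨ.isSymmSndFDerivAt (by simp)) _ _

end

section
variable {E : Type*} [NormedAddCommGroup E] [NormedSpace ℝ E]
  {H : Type*} [TopologicalSpace H] (I : ModelWithCorners ℝ E H)
  {M : Type*} [TopologicalSpace M] [ChartedSpace H M]
  {F : Type*} [NormedAddCommGroup F] [NormedSpace ℝ F]

/-- The derivative of a function at a point is the derivative of its expression in the preferred
chart at that point. -/
lemma fderiv_comp_extChartAt_symm [I.Boundaryless] {f : M → F} {q : M}
    (hf : MDifferentiableAt I 𝓘(ℝ, F) f q) :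
    fderiv ℝ (fun x => f ((extChartAt I q).symm x)) (extChartAt I q q) =
      mfderiv I 𝓘(ℝ, F) f q := by
  rw [hf.mfderiv, ModelWithCorners.range_eq_univ, fderivWithin_univ]
  rfl

end

section
variable {E : Type*} [NormedAddCommGroup E] [NormedSpace ℝ E]
  {H : Type*} [TopologicalSpace H] (I : ModelWithCorners ℝ E H)
  {G : Type*} [Group G] [TopologicalSpace G] [ChartedSpace H G] [LieGroup I ∞ G]

lemma isInvertible_mfderiv_inv (q : G) : (mfderiv I I (fun a : G => a⁻¹) q).IsInvertible := by
  let Φ : G ≃ₘ^∞⟮I, I⟯ G :=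
    { toEquiv := Equiv.inv G
      contMDiff_toFun := contMDiff_inv I ∞
      contMDiff_invFun := contMDiff_inv I ∞ }
  exact ⟨Φ.mfderivToContinuousLinearEquiv (by simp) q, rfl⟩

lemma mdifferentiable_inv : MDifferentiable I I (fun a : G => a⁻¹) :=
  (contMDiff_inv I ∞).mdifferentiable (by simp)

lemma mdifferentiable_leftMul (q : G) : MDifferentiable I I (fun a : G => q * a) :=
  (contMDiff_mul_left (I := I) (n := ∞)).mdifferentiable (by simp)

variable {F : Type*} [NormedAddCommGroup F] [NormedSpace ℝ F]

/-- The derivative of `f` along the left-invariant field is computed on curves `t ↦ q * a t`. The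
values live in the fixed space `F`, which avoids comparing tangent spaces at `q * 1` and `q`. -/
lemma mfderiv_mulInvariantVectorField {f : G → F} {q : G} (hf : MDifferentiableAt I 𝓘(ℝ, F) f q)
    (v : GroupLieAlgebra I G) :
    (mfderiv I 𝓘(ℝ, F) f q (mulInvariantVectorField v q) : F) =
      mfderiv I 𝓘(ℝ, F) (fun a => f (q * a)) 1 v := by
  have h := mfderiv_comp_of_eq (x := (1 : G)) (g := f) (f := fun a => q * a) hf
    (mdifferentiable_leftMul I q 1) (mul_one q)
  have h1 := congrArg (fun T : E →L[ℝ] F => T v) h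
  have h2 := congrArg (fun z => (mfderiv I 𝓘(ℝ, F) f z : E →L[ℝ] F) (mulInvariantVectorField v q))
    (mul_one q)
  exact h2.symm.trans h1.symm
/-- The derivative of `f` along the right-invariant field is computed on curves
`t ↦ (a t)⁻¹ * q`. -/
lemma mfderiv_rightInvariantField {f : G → F} {q : G} (hf : MDifferentiableAt I 𝓘(ℝ, F) f q)
    (v : GroupLieAlgebra I G) :
    (mfderiv I 𝓘(ℝ, F) f q (rightInvariantField I v q) : F) =
      mfderiv I 𝓘(ℝ, F) (fun a => f (a⁻¹ * q)) 1 v := by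
  have hf' : MDifferentiableAt I 𝓘(ℝ, F) (fun a => f a⁻¹) q⁻¹ :=
    MDifferentiableAt.comp_of_eq _ hf (mdifferentiable_inv I _) (inv_inv q)
  have h2 := mfderiv_mulInvariantVectorField I hf' v
  have h3 : (mfderiv I I (fun a : G => a⁻¹) q) (rightInvariantField I v q) =
      mulInvariantVectorField v q⁻¹ := by
    obtain ⟨D, hD⟩ := isInvertible_mfderiv_inv I q
    unfold rightInvariantField
    rw [mpullback_apply, ← hD, ContinuousLinearMap.inverse_equiv]
    exact D.apply_symm_apply _
  have h4 := mfderiv_comp_apply q hf' (mdifferentiable_inv I q) (rightInvariantField I v q)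
  rw [h3] at h4
  have h5 : (fun a => f a⁻¹) ∘ (fun a : G => a⁻¹) = f := by
    ext a; simp
  have h6 : (fun a => f (q⁻¹ * a)⁻¹) = fun a => f (a⁻¹ * q) := by
    ext a; simp
  rw [h5] at h4
  rw [h6] at h2
  exact h4.trans h2

/-- The field `g ↦ D_{(g, 1)} m (0, v)`, with `m` the product of `G`, is smooth because the tangent
map of `m` is. Mathlib's `contMDiff_mulInvariantVectorField` gives class `C²` only. -/
lemma contMDiff_mulInvariantVectorField_infty (v : GroupLieAlgebra I G) :
    ContMDiff I I.tangent ∞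
      (fun g : G => (⟨g, mulInvariantVectorField v g⟩ : TangentBundle I G)) := by
  let fg : G → TangentBundle I G := fun g => TotalSpace.mk' E g 0
  have sfg : ContMDiff I I.tangent ∞ fg := contMDiff_zeroSection _ _
  let fv : G → TangentBundle I G := fun _ => TotalSpace.mk' E 1 v
  have sfv : ContMDiff I I.tangent ∞ fv := contMDiff_const
  let F₁ : G → (TangentBundle I G × TangentBundle I G) := fun g => (fg g, fv g)
  have S₁ : ContMDiff I (I.tangent.prod I.tangent) ∞ F₁ := sfg.prodMk sfv
  let F₂ : (TangentBundle I G × TangentBundle I G) → TangentBundle (I.prod I) (G × G) :=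
    (equivTangentBundleProd I G I G).symm
  have S₂ : ContMDiff (I.tangent.prod I.tangent) (I.prod I).tangent ∞ F₂ :=
    contMDiff_equivTangentBundleProd_symm
  let F₃ : TangentBundle (I.prod I) (G × G) → TangentBundle I G :=
    tangentMap (I.prod I) I (fun p : G × G => p.1 * p.2)
  have S₃ : ContMDiff (I.prod I).tangent I.tangent ∞ F₃ :=
    ContMDiff.contMDiff_tangentMap (m := ∞) (contMDiff_mul I ∞) (by norm_num)
  convert! (S₃.comp S₂).comp S₁ with g
  · simp [F₁, F₂, F₃, fg, fv]
  · simp only [Function.comp_apply, tangentMap, F₃, F₂, F₁, fg, fv]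
    rw [mfderiv_prod_eq_add_apply ((contMDiff_mul I ∞).mdifferentiable (by simp) _)]
    refine Eq.trans (zero_add (mulInvariantVectorField v g)).symm
      (congrArg₂ (fun a b : E => a + b) ?_ rfl)
    exact (ContinuousLinearMap.map_zero _).symm

variable [CompleteSpace E]

lemma contMDiff_rightInvariantField (v : GroupLieAlgebra I G) :
    ContMDiff I I.tangent ∞
      (fun g : G => (⟨g, rightInvariantField I v g⟩ : TangentBundle I G)) :=
  (contMDiff_mulInvariantVectorField_infty I v).mpullback_vectorField (contMDiff_inv I ∞)
    (isInvertible_mfderiv_inv I) (by norm_num)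

/-- Pulling back by the inversion respects brackets, so that `v ↦ i_* v` is a homomorphism of Lie
algebras, with no sign. -/
lemma mlieBracket_rightInvariantField (v w : GroupLieAlgebra I G) (q : G) :
    mlieBracket I (rightInvariantField I v) (rightInvariantField I w) q =
      rightInvariantField I ⁅v, w⁆ q := by
  have h := mpullback_mlieBracket (I := I) (I' := I) (x₀ := q)
    (mdifferentiableAt_mulInvariantVectorField v) (mdifferentiableAt_mulInvariantVectorField w)
    (contMDiff_inv I ∞ q)
    (by rw [minSmoothness_of_isRCLikeNormedField]; exact WithTop.coe_le_coe.2 le_top)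
  unfold rightInvariantField
  rw [GroupLieAlgebra.bracket_def, mulInvariantVector_mlieBracket, h]

/-- Right-invariant and left-invariant fields commute: they are the two families of partial
derivatives of `(a, b) ↦ a⁻¹ * q * b` at the identity. -/
lemma mlieBracket_rightInvariantField_mulInvariantVectorField [I.Boundaryless]
    (v w : GroupLieAlgebra I G) (q : G) :
    mlieBracket I (rightInvariantField I v) (mulInvariantVectorField w) q = 0 := by
  have := topologicalGroup_of_lieGroup I ∞ (G := G)
  have hinj : Function.Injective (mfderiv I 𝓘(ℝ, E) (extChartAt I q) q) := by
    obtain ⟨D, hD⟩ := isInvertible_mfderiv_extChartAt (I := I) (mem_extChartAt_source (I := I) q)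
    rw [← hD]
    exact D.injective
  apply hinj
  rw [(mfderiv I 𝓘(ℝ, E) (extChartAt I q) q).map_zero, mfderiv_extChartAt_mlieBracket]
  set φ := extChartAt I q
  set x₀ : E := extChartAt I (1 : G) 1
  let Ψ : E × E → E := fun p =>
    φ (((extChartAt I (1 : G)).symm p.1)⁻¹ * (q * (extChartAt I (1 : G)).symm p.2))
  have h0 : Ψ (x₀, x₀) = φ q := by
    simp [Ψ, x₀]
  have key := fderiv_apply_comm_of_partial_derivatives (Ψ := Ψ) (x₀ := x₀) (y₀ := x₀) (v := v)
    (w := w) (R := fieldInChart I (rightInvariantField I v) q)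
    (L := fieldInChart I (mulInvariantVectorField w) q) ?_ ?_ ?_ ?_ ?_
  · rw [h0] at key
    exact sub_eq_zero.2 key.symm
  · have hs : ContMDiffAt 𝓘(ℝ, E) I 2 (extChartAt I (1 : G)).symm x₀ :=
      (contMDiffOn_extChartAt_symm (n := 2) (1 : G)).contMDiffAt
        (extChartAt_target_mem_nhds (I := I) (1 : G))
    have h1 : ContMDiffAt 𝓘(ℝ, E × E) I 2
        (fun p : E × E => (extChartAt I (1 : G)).symm p.1) (x₀, x₀) :=
      hs.comp_of_eq (contDiff_fst.contMDiff.contMDiffAt) rfl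
    have h2 : ContMDiffAt 𝓘(ℝ, E × E) I 2
        (fun p : E × E => (extChartAt I (1 : G)).symm p.2) (x₀, x₀) :=
      hs.comp_of_eq (contDiff_snd.contMDiff.contMDiffAt) rfl
    rw [← contMDiffAt_iff_contDiffAt]
    refine ContMDiffAt.comp_of_eq (y := q) (contMDiffAt_extChartAt (I := I) (n := 2) (x := q))
      (h1.inv.mul (contMDiffAt_const.mul h2)) ?_
    simp [x₀]
  · rw [h0]
    exact differentiableAt_fieldInChart I
      ((contMDiff_rightInvariantField I v).mdifferentiable (by simp) _)
  · rw [h0]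
    exact differentiableAt_fieldInChart I
      ((contMDiff_mulInvariantVectorField_infty I w).mdifferentiable (by simp) _)
  · have ht : Filter.Tendsto (fun y => q * (extChartAt I (1 : G)).symm y) (nhds x₀) (nhds q) := by
      have : ContinuousAt (fun y => q * (extChartAt I (1 : G)).symm y) x₀ :=
        continuousAt_const.mul (continuousAt_extChartAt_symm (I := I) (1 : G))
      simpa [ContinuousAt, x₀] using this
    filter_upwards [ht (extChartAt_source_mem_nhds (I := I) q)] with y hy
    have hy' : q * (extChartAt I (1 : G)).symm y ∈ φ.source := hy
    have hφ : MDifferentiableAt I 𝓘(ℝ, E) φ (q * (extChartAt I (1 : G)).symm y) :=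
      mdifferentiableAt_extChartAt (by rwa [← extChartAt_source I])
    have e1 : Ψ (x₀, y) = φ (q * (extChartAt I (1 : G)).symm y) := by
      simp [Ψ, x₀]
    rw [e1, fieldInChart_extChartAt I _ hy']
    refine (mfderiv_rightInvariantField I hφ v).trans ?_
    have hd : MDifferentiableAt I 𝓘(ℝ, E)
        (fun a => φ (a⁻¹ * (q * (extChartAt I (1 : G)).symm y))) 1 :=
      hφ.comp_of_eq _ ((((contMDiff_inv I ∞).mul contMDiff_const).mdifferentiable (by simp)) _)
        (by simp)
    exact congrArg (fun T : E →L[ℝ] E => T v) (fderiv_comp_extChartAt_symm I hd).symm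
  · have ht : Filter.Tendsto (fun x => ((extChartAt I (1 : G)).symm x)⁻¹ * q)
        (nhds x₀) (nhds q) := by
      have : ContinuousAt (fun x => ((extChartAt I (1 : G)).symm x)⁻¹ * q) x₀ :=
        (continuousAt_extChartAt_symm (I := I) (1 : G)).inv.mul continuousAt_const
      simpa [ContinuousAt, x₀] using this
    filter_upwards [ht (extChartAt_source_mem_nhds (I := I) q)] with x hx
    have hx' : ((extChartAt I (1 : G)).symm x)⁻¹ * q ∈ φ.source := hx
    have hφ : MDifferentiableAt I 𝓘(ℝ, E) φ (((extChartAt I (1 : G)).symm x)⁻¹ * q) :=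
      mdifferentiableAt_extChartAt (by rwa [← extChartAt_source I])
    have e1 : Ψ (x, x₀) = φ (((extChartAt I (1 : G)).symm x)⁻¹ * q) := by
      simp [Ψ, x₀]
    rw [e1, fieldInChart_extChartAt I _ hx']
    refine (mfderiv_mulInvariantVectorField I hφ w).trans ?_
    have hd : MDifferentiableAt I 𝓘(ℝ, E)
        (fun b => φ (((extChartAt I (1 : G)).symm x)⁻¹ * q * b)) 1 :=
      hφ.comp_of_eq _ (mdifferentiable_leftMul I _ 1) (mul_one _)
    have e2 : (fun y => Ψ (x, y)) = fun y =>
        φ (((extChartAt I (1 : G)).symm x)⁻¹ * q * (extChartAt I (1 : G)).symm y) := by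
      ext y
      simp only [Ψ, mul_assoc]
    rw [e2]
    exact congrArg (fun T : E →L[ℝ] E => T w) (fderiv_comp_extChartAt_symm I hd).symm

end

/-! ### The left and right Hamiltonians and their brackets -/

section
variable {E : Type*} [NormedAddCommGroup E] [NormedSpace ℝ E]
  {H : Type*} [TopologicalSpace H] (I : ModelWithCorners ℝ E H)
  {G : Type*} [Group G] [TopologicalSpace G] [ChartedSpace H G]

/-- Left translation of the Lie algebra to the tangent space at `q`: its value at `v` is the value
at `q` of the left-invariant field of `v`. -/
noncomputable def leftTranslation (q : G) : GroupLieAlgebra I G →L[ℝ] TangentSpace I q :=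
  mfderiv I I (q * ·) (1 : G)

/-- Right translation of the Lie algebra to the tangent space at `q`, up to the sign that comes from
the inversion: its value at `v` is the value at `q` of `rightInvariantField I v`. -/
noncomputable def rightTranslation (q : G) : GroupLieAlgebra I G →L[ℝ] TangentSpace I q :=
  (mfderiv I I (fun a : G => a⁻¹) q).inverse.comp (leftTranslation I q⁻¹)

lemma rightHamiltonian_sum_smul [IsManifold I 1 G] {ι : Type*} [Fintype ι] (c : ι → ℝ)
    (f : ι → GroupLieAlgebra I G) (l : CotangentBundle I G) :
    rightHamiltonian I (∑ i, c i • f i) l = ∑ i, c i * rightHamiltonian I (f i) l := by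
  let T : GroupLieAlgebra I G →L[ℝ] ℝ := l.2.comp (rightTranslation I l.1)
  change T (∑ i, c i • f i) = ∑ i, c i * T (f i)
  simp

variable [LieGroup I ∞ G]

lemma leftTranslation_injective (q : G) : Function.Injective (leftTranslation I q) := by
  let Φ : G ≃ₘ^∞⟮I, I⟯ G :=
    { toEquiv := Equiv.mulLeft q
      contMDiff_toFun := contMDiff_mul_left
      contMDiff_invFun := contMDiff_mul_left (a := q⁻¹) }
  exact (Φ.mfderivToContinuousLinearEquiv (by simp) 1).injective

lemma rightTranslation_injective (q : G) : Function.Injective (rightTranslation I q) := by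
  obtain ⟨D, hD⟩ := isInvertible_mfderiv_inv I q
  unfold rightTranslation
  rw [← hD, ContinuousLinearMap.inverse_equiv]
  exact D.symm.injective.comp (leftTranslation_injective I q⁻¹)

lemma mulInvariantVectorField_ne_zero {v : GroupLieAlgebra I G} (hv : v ≠ 0) (q : G) :
    mulInvariantVectorField v q ≠ 0 :=
  fun h => hv (leftTranslation_injective I q (h.trans (map_zero (leftTranslation I q)).symm))

lemma rightInvariantField_ne_zero {v : GroupLieAlgebra I G} (hv : v ≠ 0) (q : G) :
    rightInvariantField I v q ≠ 0 :=
  fun h => hv (rightTranslation_injective I q (h.trans (map_zero (rightTranslation I q)).symm))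

lemma contMDiff_leftHamiltonian (v : GroupLieAlgebra I G) :
    ContMDiff (cotangentModel I) 𝓘(ℝ, ℝ) ∞ (leftHamiltonian I v) :=
  contMDiff_linearHamiltonian I (contMDiff_mulInvariantVectorField_infty I v)

lemma contMDiff_subRiemannianHamiltonian (v w : GroupLieAlgebra I G) :
    ContMDiff (cotangentModel I) 𝓘(ℝ, ℝ) ∞ (subRiemannianHamiltonian I v w) := by
  have hF : ContDiff ℝ ∞ (fun x : ℝ × ℝ => (x.1 ^ 2 + x.2 ^ 2) / 2) := by fun_prop
  exact hF.contMDiff.comp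
    ((contMDiff_leftHamiltonian I v).prodMk_space (contMDiff_leftHamiltonian I w))

lemma differential_subRiemannianHamiltonian (v w : GroupLieAlgebra I G) (l : CotangentBundle I G)
    (X : TangentSpace (cotangentModel I) l) :
    differential (cotangentModel I) (subRiemannianHamiltonian I v w) l X =
      leftHamiltonian I v l * differential (cotangentModel I) (leftHamiltonian I v) l X +
      leftHamiltonian I w l * differential (cotangentModel I) (leftHamiltonian I w) l X := by
  have hv := ((contMDiff_leftHamiltonian I v).mdifferentiable (by simp) l).hasMFDerivAt
  have hw := ((contMDiff_leftHamiltonian I w).mdifferentiable (by simp) l).hasMFDerivAt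
  have h := (((hv.mul hv).add (hw.mul hw)).const_smul (2⁻¹ : ℝ)).mfderiv
  have hH : subRiemannianHamiltonian I v w =
      (2⁻¹ : ℝ) • (leftHamiltonian I v * leftHamiltonian I v +
        leftHamiltonian I w * leftHamiltonian I w) := by
    ext l
    simp only [subRiemannianHamiltonian, Pi.smul_apply, Pi.add_apply, Pi.mul_apply, smul_eq_mul]
    ring
  unfold differential
  rw [hH, h]
  have key : ∀ a b x y : ℝ, 2⁻¹ * ((a * x + a * x) + (b * y + b * y)) = a * x + b * y := by
    intros; ring
  exact key _ _ _ _

local notation "PB" => poissonBracket (cotangentModel I) (canonicalForm I G)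

lemma poissonBracket_subRiemannianHamiltonian [FiniteDimensional ℝ E] [I.Boundaryless]
    (a : CotangentBundle I G → ℝ)
    (v w : GroupLieAlgebra I G) (l : CotangentBundle I G) :
    PB a (subRiemannianHamiltonian I v w) l =
      leftHamiltonian I v l * PB a (leftHamiltonian I v) l +
      leftHamiltonian I w l * PB a (leftHamiltonian I w) l := by
  simp only [poissonBracket_eq_differential (nondegenerate_canonicalForm I l),
    differential_subRiemannianHamiltonian]

variable [CompleteSpace E]

lemma contMDiff_rightHamiltonian (v : GroupLieAlgebra I G) :
    ContMDiff (cotangentModel I) 𝓘(ℝ, ℝ) ∞ (rightHamiltonian I v) :=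
  contMDiff_linearHamiltonian I (contMDiff_rightInvariantField I v)

/-- Hamiltonians of linearly independent right-invariant fields are functionally independent:
already their derivatives along the fibre are. -/
lemma linearIndependent_differential_rightHamiltonian [I.Boundaryless] {ι : Type*}
    [Fintype ι]
    {f : ι → GroupLieAlgebra I G} (hf : LinearIndependent ℝ f) (l : CotangentBundle I G) :
    LinearIndependent ℝ fun i => differential (cotangentModel I) (rightHamiltonian I (f i)) l := by
  have hfield : ∀ v, fieldInChart I (rightInvariantField I v) l.1 (extChartAt I l.1 l.1) =
      mfderiv I 𝓘(ℝ, E) (extChartAt I l.1) l.1 (rightTranslation I l.1 v) := fun v =>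
    fieldInChart_extChartAt I _ (mem_extChartAt_source l.1)
  rw [Fintype.linearIndependent_iff] at hf ⊢
  intro c hc
  apply hf
  apply rightTranslation_injective I l.1
  obtain ⟨D, hD⟩ := isInvertible_mfderiv_extChartAt (I := I) (mem_extChartAt_source (I := I) l.1)
  apply D.injective
  rw [(rightTranslation I l.1).map_zero, D.map_zero]
  refine SeparatingDual.eq_zero_of_forall_dual_eq_zero (R := ℝ) (V := E) fun p => ?_
  -- a vertical vector: along it the functions vary as `p` paired with the fields
  obtain ⟨X, hX⟩ := (cotangentCoord_bijective I l).2 (0, p)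
  have h1 : ∀ i, differential (cotangentModel I) (rightHamiltonian I (f i)) l X =
      p (D (rightTranslation I l.1 (f i))) := by
    intro i
    refine (differential_linearHamiltonian I
      ((contMDiff_rightInvariantField I (f i)).mdifferentiable (by simp) _) X).trans ?_
    rw [hX, hfield, ← hD]
    have hz : ∀ S : E →L[ℝ] E, (extChartAt (cotangentModel I) l l).2 (S 0) = 0 := fun S => by
      rw [map_zero, map_zero]
    exact (congrArg (_ + ·) (hz _)).trans (add_zero _)
  let T : GroupLieAlgebra I G →L[ℝ] ℝ :=
    p.comp (show GroupLieAlgebra I G →L[ℝ] E from D.toContinuousLinearMap.comp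
      (rightTranslation I l.1))
  have h2 := congrArg (fun S => S X) hc
  have h3 : T (∑ i, c i • f i) = 0 := by
    rw [map_sum]
    refine Eq.trans (Finset.sum_congr rfl fun i _ => ?_)
      ((sum_apply _ _ _).symm.trans h2)
    rw [map_smul]
    exact congrArg (c i • ·) (h1 i).symm
  exact h3

variable [FiniteDimensional ℝ E] [I.Boundaryless]

lemma poissonBracket_leftHamiltonian (v w : GroupLieAlgebra I G) (l : CotangentBundle I G) :
    PB (leftHamiltonian I v) (leftHamiltonian I w) l = leftHamiltonian I ⁅v, w⁆ l := by
  unfold leftHamiltonian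
  rw [poissonBracket_linearHamiltonian I
    ((contMDiff_mulInvariantVectorField_infty I v).mdifferentiable (by simp) _)
    ((contMDiff_mulInvariantVectorField_infty I w).mdifferentiable (by simp) _),
    GroupLieAlgebra.bracket_def, mulInvariantVector_mlieBracket]

lemma poissonBracket_rightHamiltonian (v w : GroupLieAlgebra I G) (l : CotangentBundle I G) :
    PB (rightHamiltonian I v) (rightHamiltonian I w) l = rightHamiltonian I ⁅v, w⁆ l := by
  unfold rightHamiltonian
  rw [poissonBracket_linearHamiltonian I
    ((contMDiff_rightInvariantField I v).mdifferentiable (by simp) _)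
    ((contMDiff_rightInvariantField I w).mdifferentiable (by simp) _)]
  exact congrArg l.2 (mlieBracket_rightInvariantField I v w l.1)

lemma poissonBracket_rightHamiltonian_leftHamiltonian (v w : GroupLieAlgebra I G)
    (l : CotangentBundle I G) :
    PB (rightHamiltonian I v) (leftHamiltonian I w) l = 0 := by
  unfold rightHamiltonian leftHamiltonian
  rw [poissonBracket_linearHamiltonian I
    ((contMDiff_rightInvariantField I v).mdifferentiable (by simp) _)
    ((contMDiff_mulInvariantVectorField_infty I w).mdifferentiable (by simp) _)]
  exact (congrArg l.2
    (mlieBracket_rightInvariantField_mulInvariantVectorField I v w l.1)).trans (map_zero _)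

lemma poissonBracket_subRiemannianHamiltonian_rightHamiltonian (u v w : GroupLieAlgebra I G)
    (l : CotangentBundle I G) :
    PB (subRiemannianHamiltonian I v w) (rightHamiltonian I u) l = 0 := by
  rw [poissonBracket_canonicalForm_swap, poissonBracket_subRiemannianHamiltonian,
    poissonBracket_rightHamiltonian_leftHamiltonian,
    poissonBracket_rightHamiltonian_leftHamiltonian]
  simp

end

/-! ### Superintegrability -/

/-- A skew-symmetric matrix of order four with a vanishing row is a skew-symmetric one of order
three, hence of rank two as soon as it is not zero. -/
lemma rank_eq_two_of_skew (A : Matrix (Fin 4) (Fin 4) ℝ) (h0 : ∀ j, A 0 j = 0)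
    (hA : ∀ i j, A i j = - A j i) (h : A 3 2 ≠ 0) : A.rank = 2 := by
  have hd : ∀ i, A i i = 0 := fun i => by linarith [hA i i]
  apply le_antisymm
  · -- rows `2` and `3` span the row space: by skew symmetry, row `1` is the combination of
    -- them whose coefficients are read off from columns `3` and `2`
    have : A = (!![0, 0; A 1 3 / A 2 3, - A 1 2 / A 2 3; 1, 0; 0, 1] : Matrix (Fin 4) (Fin 2) ℝ) *
        A.submatrix ![2, 3] id := by
      have h23 : A 2 3 ≠ 0 := by rw [hA]; exact neg_ne_zero.2 h
      ext i j
      rw [Matrix.mul_apply, Fin.sum_univ_two]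
      fin_cases i <;> fin_cases j <;>
        simp [h0, hd, hA 1 0, hA 2 0, hA 3 0, hA 2 1, hA 3 1, hA 3 2] <;> field_simp
      ring
    rw [this]
    exact (Matrix.rank_mul_le_left _ _).trans (Matrix.rank_le_width _)
  · have h2 : (A.submatrix ![2, 3] ![2, 3]).rank = 2 := by
      rw [Matrix.rank_of_isUnit]
      · simp
      · rw [Matrix.isUnit_iff_isUnit_det, Matrix.det_fin_two]
        simp [hd, hA 2 3, h]
    rw [← h2]
    exact Matrix.rank_submatrix_le _ _ _

section
variable {E : Type*} [NormedAddCommGroup E] [NormedSpace ℝ E] [CompleteSpace E]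
  {H : Type*} [TopologicalSpace H] (I : ModelWithCorners ℝ E H)
  {G : Type*} [Group G] [TopologicalSpace G] [ChartedSpace H G] [LieGroup I ∞ G]

/-- The matrix of brackets of `H, g₀, g₁, g₂` as a function of the values `y` of these four
functions: zero row and column for `H`, and for the `gᵢ` the linear functions of `y 1, y 2, y 3`
given by the structure constants of the Lie algebra in the basis `b`. -/
noncomputable def bracketMatrix (b : Module.Basis (Fin 3) ℝ (GroupLieAlgebra I G))
    (y : Fin 4 → ℝ) : Matrix (Fin 4) (Fin 4) ℝ :=
  fun i j => Fin.cases 0 (fun i' => Fin.cases 0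
    (fun j' => ∑ k, b.repr ⁅b i', b j'⁆ k * y k.succ) j) i

/-- The entry `{g₂, g₁} = g₀` is `y 1`, so that the matrix is not zero if `y 1 ≠ 0`. -/
lemma rank_bracketMatrix {b : Module.Basis (Fin 3) ℝ (GroupLieAlgebra I G)}
    (hb : b 0 = ⁅b 2, b 1⁆) {y : Fin 4 → ℝ} (hy : y 1 ≠ 0) : (bracketMatrix I b y).rank = 2 := by
  apply rank_eq_two_of_skew
  · intro j
    rfl
  · intro i j
    refine Fin.cases ?_ (fun i' => ?_) i <;> refine Fin.cases ?_ (fun j' => ?_) j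
    · exact neg_zero.symm
    · exact neg_zero.symm
    · exact neg_zero.symm
    · change ∑ k, b.repr ⁅b i', b j'⁆ k * y k.succ = -∑ k, b.repr ⁅b j', b i'⁆ k * y k.succ
      rw [← lie_skew, map_neg, ← Finset.sum_neg_distrib]
      exact Finset.sum_congr rfl fun k _ => neg_mul _ _
  · have h : bracketMatrix I b y 3 2 = ∑ k, b.repr ⁅b 2, b 1⁆ k * y k.succ := rfl
    rw [h, ← hb, b.repr_self]
    simpa [Finsupp.single_apply] using hy

variable [FiniteDimensional ℝ E] [I.Boundaryless]

/-- The Hamiltonian field of `h₂` annihilates every `gᵢ`, and `{h₂, H} = h₁ h₀`. Hence `dH` is not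
a combination of the `dgᵢ` where `h₀ h₁ ≠ 0`. -/
lemma functionallyIndependentOn_subRiemannianHamiltonian {f : Fin 3 → GroupLieAlgebra I G}
    (hf : LinearIndependent ℝ f) (hf₀ : f 0 = ⁅f 2, f 1⁆) :
    FunctionallyIndependentOn (cotangentModel I)
      ![subRiemannianHamiltonian I (f 1) (f 2), rightHamiltonian I (f 0),
        rightHamiltonian I (f 1), rightHamiltonian I (f 2)]
      {l | leftHamiltonian I (f 0) l * leftHamiltonian I (f 1) l ≠ 0} := by
  intro l hl
  have hl' : leftHamiltonian I (f 0) l * leftHamiltonian I (f 1) l ≠ 0 := hl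
  rw [Fintype.linearIndependent_iff]
  intro c hc
  rw [Fin.sum_univ_four] at hc
  set X := hamiltonianField (cotangentModel I) (canonicalForm I G) (leftHamiltonian I (f 2)) l
  have hX : ∀ b, differential (cotangentModel I) b l X =
      poissonBracket (cotangentModel I) (canonicalForm I G) (leftHamiltonian I (f 2)) b l :=
    fun b => (poissonBracket_eq_differential (nondegenerate_canonicalForm I l) _ b).symm
  have hg : ∀ v, differential (cotangentModel I) (rightHamiltonian I v) l X = 0 := fun v => by
    rw [hX, poissonBracket_canonicalForm_swap, poissonBracket_rightHamiltonian_leftHamiltonian,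
      neg_zero]
  have hH : differential (cotangentModel I) (subRiemannianHamiltonian I (f 1) (f 2)) l X =
      leftHamiltonian I (f 0) l * leftHamiltonian I (f 1) l := by
    have h22 := poissonBracket_canonicalForm_swap I (leftHamiltonian I (f 2))
      (leftHamiltonian I (f 2)) l
    rw [hX, poissonBracket_subRiemannianHamiltonian, poissonBracket_leftHamiltonian, ← hf₀]
    rw [self_eq_neg] at h22
    rw [h22, mul_zero, add_zero, mul_comm]
  have hc0 : c 0 = 0 := by
    have h1 : c 0 * differential (cotangentModel I) (subRiemannianHamiltonian I (f 1) (f 2)) l X +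
        c 1 * differential (cotangentModel I) (rightHamiltonian I (f 0)) l X +
        c 2 * differential (cotangentModel I) (rightHamiltonian I (f 1)) l X +
        c 3 * differential (cotangentModel I) (rightHamiltonian I (f 2)) l X = 0 :=
      congrArg (fun T => T X) hc
    rw [hg, hg, hg, hH] at h1
    simpa [hl'] using h1
  have hr := Fintype.linearIndependent_iff.1
    (linearIndependent_differential_rightHamiltonian I hf l) (fun i => c i.succ) (by
      rw [hc0, zero_smul, zero_add] at hc
      rw [Fin.sum_univ_three]
      exact hc)
  exact Fin.cases hc0 hr

lemma poissonBracket_eq_bracketMatrix (b : Module.Basis (Fin 3) ℝ (GroupLieAlgebra I G))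
    {F : Fin 4 → CotangentBundle I G → ℝ} (hF₀ : F 0 = subRiemannianHamiltonian I (b 1) (b 2))
    (hF : ∀ i : Fin 3, F i.succ = rightHamiltonian I (b i)) (i j : Fin 4)
    (l : CotangentBundle I G) :
    poissonBracket (cotangentModel I) (canonicalForm I G) (F i) (F j) l =
      bracketMatrix I b (fun k => F k l) i j := by
  refine Fin.cases ?_ (fun i' => ?_) i <;> refine Fin.cases ?_ (fun j' => ?_) j
  · refine self_eq_neg.1 ?_
    exact poissonBracket_canonicalForm_swap I _ _ l
  · rw [hF, hF₀]
    exact poissonBracket_subRiemannianHamiltonian_rightHamiltonian I _ _ _ l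
  · rw [poissonBracket_canonicalForm_swap, hF, hF₀,
      poissonBracket_subRiemannianHamiltonian_rightHamiltonian, neg_zero]
    rfl
  · change _ = ∑ k, b.repr ⁅b i', b j'⁆ k * F k.succ l
    simp only [hF]
    rw [poissonBracket_rightHamiltonian, ← rightHamiltonian_sum_smul, b.sum_repr]

theorem isSuperintegrableBy_subRiemannianHamiltonian (hE : Module.finrank ℝ E = 3)
    {f : Fin 3 → GroupLieAlgebra I G} (hf : LinearIndependent ℝ f) (hf₀ : f 0 = ⁅f 2, f 1⁆) :
    IsSuperintegrableBy (cotangentModel I) (canonicalForm I G) 3 2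
      ![subRiemannianHamiltonian I (f 1) (f 2), rightHamiltonian I (f 0),
        rightHamiltonian I (f 1), rightHamiltonian I (f 2)] := by
  set F := ![subRiemannianHamiltonian I (f 1) (f 2), rightHamiltonian I (f 0),
        rightHamiltonian I (f 1), rightHamiltonian I (f 2)] with hFdef
  have : FiniteDimensional ℝ (GroupLieAlgebra I G) := inferInstanceAs (FiniteDimensional ℝ E)
  let b : Module.Basis (Fin 3) ℝ (GroupLieAlgebra I G) :=
    basisOfLinearIndependentOfCardEqFinrank hf (by rw [Fintype.card_fin]; exact hE.symm)
  have hb : ⇑b = f := coe_basisOfLinearIndependentOfCardEqFinrank _ _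
  have hF₀ : F 0 = subRiemannianHamiltonian I (b 1) (b 2) := by rw [hb]; rfl
  have hF : ∀ i : Fin 3, F i.succ = rightHamiltonian I (b i) := by
    rw [hb]
    intro i
    fin_cases i <;> rfl
  have hsmooth : ∀ i, ContMDiff (cotangentModel I) 𝓘(ℝ, ℝ) ∞ (F i) := by
    refine Fin.cases ?_ fun i => ?_
    · rw [hF₀]
      exact contMDiff_subRiemannianHamiltonian I _ _
    · rw [hF]
      exact contMDiff_rightHamiltonian I _
  have hbracket := poissonBracket_eq_bracketMatrix I b hF₀ hF
  refine ⟨?_, rfl, nondegenerate_canonicalForm I, hsmooth, ?_, ?_, ?_⟩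
  · rw [Module.finrank_prod, ← (LinearMap.toContinuousLinearMap (𝕜 := ℝ) (E := E)
      (F' := ℝ)).finrank_eq, Subspace.dual_finrank_eq, hE]
  · intro i l
    rw [hbracket]
    rfl
  · refine ⟨_, ?_, ?_, functionallyIndependentOn_subRiemannianHamiltonian I hf hf₀⟩
    · exact isOpen_ne_fun ((contMDiff_leftHamiltonian I (f 0)).continuous.mul
        (contMDiff_leftHamiltonian I (f 1)).continuous) continuous_const
    · have hset : {l : CotangentBundle I G |
          leftHamiltonian I (f 0) l * leftHamiltonian I (f 1) l ≠ 0} =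
          {l | leftHamiltonian I (f 0) l ≠ 0} ∩ {l | leftHamiltonian I (f 1) l ≠ 0} := by
        ext l
        exact mul_ne_zero_iff
      rw [hset]
      refine (dense_linearHamiltonian_ne_zero I
        (mulInvariantVectorField_ne_zero I (hf.ne_zero 0))).inter_of_isOpen_left
        (dense_linearHamiltonian_ne_zero I
        (mulInvariantVectorField_ne_zero I (hf.ne_zero 1))) ?_
      exact isOpen_ne_fun (contMDiff_leftHamiltonian I (f 0)).continuous continuous_const
  · refine ⟨fun y => bracketMatrix I b y, hbracket, {y | y.1 1 ≠ 0}, ?_, ?_, fun y hy => ?_⟩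
    · exact isOpen_ne_fun ((continuous_apply 1).comp continuous_subtype_val) continuous_const
    · have hcont : Continuous (fun x i => F i x) := continuous_pi fun i => (hsmooth i).continuous
      -- the image of a dense set under a continuous surjection is dense
      have hd := (Set.rangeFactorization_surjective (f := fun x i => F i x)).denseRange.dense_image
        (hcont.subtype_mk Set.mem_range_self) (dense_linearHamiltonian_ne_zero I
          (rightInvariantField_ne_zero I (hf.ne_zero 0)))
      refine hd.mono ?_
      rintro _ ⟨l, hl, rfl⟩
      exact hl
    · rw [rank_bracketMatrix I (by rw [hb]; exact hf₀) hy]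

end

theorem theorem2 {G : Type*} [Group G] [TopologicalSpace G]
    [ChartedSpace (EuclideanSpace ℝ (Fin 3)) G] [LieGroup (𝓡 3) ∞ G]
    [ConnectedSpace G] (hG : IsUnimodular (𝓡 3) G)
    (f : Fin 3 → GroupLieAlgebra (𝓡 3) G) (hf : LinearIndependent ℝ f)
    (hf₀ : f 0 = ⁅f 2, f 1⁆) :
    let H : CotangentBundle (𝓡 3) G → ℝ := subRiemannianHamiltonian (𝓡 3) (f 1) (f 2)
    let h : Fin 3 → CotangentBundle (𝓡 3) G → ℝ := fun i => leftHamiltonian (𝓡 3) (f i)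
    let g : Fin 3 → CotangentBundle (𝓡 3) G → ℝ := fun i => rightHamiltonian (𝓡 3) (f i)
    (∀ i l, poissonBracket (cotangentModel (𝓡 3)) (canonicalForm (𝓡 3) G) H (g i) l = 0) ∧
    FunctionallyIndependentOn (cotangentModel (𝓡 3)) ![H, g 0, g 1, g 2]
      {l | h 0 l * h 1 l ≠ 0} ∧
    IsSuperintegrableBy (cotangentModel (𝓡 3)) (canonicalForm (𝓡 3) G) 3 2
      ![H, g 0, g 1, g 2] ∧
    IsSuperintegrable (cotangentModel (𝓡 3)) (canonicalForm (𝓡 3) G) 3 2 H := by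
  intro H h g
  have hS := isSuperintegrableBy_subRiemannianHamiltonian (𝓡 3) finrank_euclideanSpace_fin hf hf₀
  exact ⟨fun i l => poissonBracket_subRiemannianHamiltonian_rightHamiltonian (𝓡 3) _ _ _ l,
    functionallyIndependentOn_subRiemannianHamiltonian (𝓡 3) hf hf₀, hS,
    ⟨4, inferInstance, _, rfl, hS⟩⟩
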